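/- Let $A\subset\mathbb{Z}^d$ be a finite set that affinely spans $\mathbb{R}^d$, and let $A'\subsetneq A$. The torus $T=(\mathbb{C}^*)^{d+1}=\mathbb{C}^*\times(\mathbb{C}^*)^d$ acts on $\mathbb{C}^A$, the space of sections $s=\sum_{\alpha\in A}c_\alpha s_\alpha$ (equivalently of Laurent polynomials $\sum_{\alpha\in A} c_\alpha x^\alpha$), by $(\lambda,\eta)\cdot(c_\alpha)=(\lambda\eta^\alpha c_\alpha)$. A section is very full if all $c_\alpha$ are nonzero. Let $E_A(f)=R_A(f,x_1\partial_1 f,\dots,x_d\partial_d f)$ be the principal $A$-determinant, where $R_A$ (the $A$-resultant) is the equation of the hypersurface in $(\mathbb{C}^A)^{d+1}$ that is the closure of the set of tuples $(f_0,\dots,f_d)$ with a common zero in $(\mathbb{C}^*)^d$, and let $\mathcal{E}_A=\{E_A=0\}\subset\mathbb{C}^A$, taken with its reduced structure. An $A'$-sharpened pencil is a plane $W\subset\mathbb{C}^A$ with a basis $s_1=\sum_{\alpha\in A}c_\alpha s_\alpha$, $s_\infty=\sum_{\alpha\in A'}c_\alpha s_\alpha$, where $s_1$ is very full. For a very full $s\in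 W$ let $i_W(z)=\gamma(z)\cdot s$ for $z\in\mathbb{C}^*$, where $\gamma(z)$ multiplies the coefficients with $\alpha\in A'$ by $z$ and fixes the others; $i_W$ depends on the choice of $s$. Let $V_{A,A'}$, with the topology of the Grassmannian, be the set of $A'$-sharpened pencils $W$ transverse to $\mathcal{E}_A$ along $i_W(\mathbb{C}^*)$: at every very full $p\in W\cap\mathcal{E}_A$ the hypersurface $\mathcal{E}_A$ is smooth and $W+T_p\mathcal{E}_A=\mathbb{C}^A$. Let $V^r_{A,A'}\subset V_{A,A'}$ be the set of those $W$ with $|i_W^{-1}(\mathcal{E}_A)|=r$ for every choice of $i_W$. Let $E_r=(\mathbb{C}^*)^r/\mathfrak{S}_r$ and $\tilde E_r=E_r/\mathbb{C}^*$ ($\mathbb{C}^*$ acting by multiplication), with the quotient topologies. Then: 1. Every $W\in V_{A,A'}$ lies in $V^r_{A,A'}$ for some integer $r\ge 0$; that is, $i_W^{-1}(\mathcal{E}_A)$ is finite and its cardinality does not depend on the choice of $i_W$. 2. For every $r$, $V^r_{A,A'}$ is invariant under $T$. Let $\mathcal{V}^r_{A,A'}=V^r_{A,A'}/T$, with the quotient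 topology. 3. For every $r$ and every choice of the maps $i_W$, $W\in V^r_{A,A'}$, let $\mathbf{c}:V^r_{A,A'}\to E_r$ be the map $\mathbf{c}(W)=i_W^{-1}(\mathcal{E}_A)$. It is continuous whenever the very full section $s\in W$ defining $i_W$ depends continuously on $W$. There is a continuous map $\tilde{\mathbf{c}}:\mathcal{V}^r_{A,A'}\to\tilde E_r$, the same for all choices of the $i_W$, such that the diagram $$\begin{array}{ccc} V^r_{A,A'} & \xrightarrow{\ \mathbf{c}\ } & E_r\\ \downarrow & & \downarrow\\ \mathcal{V}^r_{A,A'} & \xrightarrow{\ \tilde{\mathbf{c}}\ } & \tilde E_r\end{array}$$ commutes. In particular, if all $W\in V_{A,A'}$ have the same number $r$ of points in $i_W^{-1}(\mathcal{E}_A)$, this holds with $V_{A,A'}$ in place of $V^r_{A,A'}$. -/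

import Mathlib

open Topology

noncomputable section

namespace SharpenedPencil

variable {d : ℕ}

/-! ### The torus, its action on sections, and Laurent polynomials with exponents in `A` -/

/-- The linear system `L_A = ℂ^A`: the section `∑ c_α s_α` is given by its coefficients. -/
abbrev Sections (A : Finset (Fin d → ℤ)) : Type := A → ℂ

/-- Very full sections: every coefficient is nonzero. -/
def VeryFull {A : Finset (Fin d → ℤ)} (s : Sections A) : Prop := ∀ α, s α ≠ 0

/-- The value at `x ∈ (ℂ^*)^d` of the monomial with exponent `α ∈ ℤ^d`. -/
def monomialAt (x : Fin d → ℂˣ) (α : Fin d → ℤ) : ℂˣ := ∏ i, x i ^ α i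

/-- The Laurent polynomial `∑ c_α x^α` evaluated at a point of the torus `(ℂ^*)^d`. -/
def laurentEval {A : Finset (Fin d → ℤ)} (s : Sections A) (x : Fin d → ℂˣ) : ℂ :=
  ∑ α : A, s α * (monomialAt x α : ℂ)

/-- The torus `(ℂ^*)^{d+1} = ℂ^* × (ℂ^* ⊗ N)`. -/
abbrev BigTorus (d : ℕ) : Type := ℂˣ × (Fin d → ℂˣ)

/-- The action of `(lam, eta) ∈ (ℂ^*)^{d+1}` on `ℂ^A`, `c_α ↦ lam * eta^α * c_α`. -/
def torusEquiv (A : Finset (Fin d → ℤ)) (t : BigTorus d) : Sections A ≃ₗ[ℂ] Sections A :=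
  LinearEquiv.piCongrRight fun α : A =>
    LinearEquiv.smulOfUnit (t.1 * monomialAt t.2 (α : Fin d → ℤ))

/-! ### The principal `A`-determinant -/

/-- The tuples `(f_0, …, f_d)` in `(ℂ^A)^{d+1}` having a common zero in `(ℂ^*)^d`. -/
def commonZeroTuples (A : Finset (Fin d → ℤ)) : Set (Fin (d + 1) × A → ℂ) :=
  {F | ∃ x : Fin d → ℂˣ, ∀ j, laurentEval (fun α : A => F (j, α)) x = 0}

open Classical in
/-- The `A`-resultant `R_A`, up to a nonzero constant: the equation of the Zariski closure of
`commonZeroTuples A`, that is, the generator of its vanishing ideal. This closure is an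
irreducible hypersurface whenever `A` affinely spans `ℝ^d`, so that the value `0` is never
taken then. -/
def aResultant (A : Finset (Fin d → ℤ)) : MvPolynomial (Fin (d + 1) × A) ℂ :=
  if h : ∃ R : MvPolynomial (Fin (d + 1) × A) ℂ,
      MvPolynomial.vanishingIdeal ℂ (commonZeroTuples A) = Ideal.span {R}
  then h.choose else 0

/-- The exponent vector `(1, α) ∈ ℤ^{d+1}`. -/
def homogenized (α : Fin d → ℤ) : Fin (d + 1) → ℤ := Fin.cons 1 α

/-- The principal `A`-determinant `E_A(f) = R_A(f, x_1 ∂f/∂x_1, …, x_d ∂f/∂x_d)`, as a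
polynomial in the coefficients `c_α` of `f`; the `j`-th entry `x_j ∂f/∂x_j` has
coefficients `α_j c_α`. -/
def principalDeterminant (A : Finset (Fin d → ℤ)) : MvPolynomial A ℂ :=
  MvPolynomial.aeval
    (fun jα : Fin (d + 1) × A =>
      MvPolynomial.C ((homogenized (jα.2 : Fin d → ℤ) jα.1 : ℤ) : ℂ) * MvPolynomial.X jα.2)
    (aResultant A)

/-- The zero locus `𝓔_A ⊂ ℂ^A` of the principal `A`-determinant. -/
def detLocus (A : Finset (Fin d → ℤ)) : Set (Sections A) :=
  {s | MvPolynomial.eval s (principalDeterminant A) = 0}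

/-- The Zariski tangent space at `p` of the (reduced) subvariety `Z` of `ℂ^A`. -/
def zariskiTangent {A : Finset (Fin d → ℤ)} (Z : Set (Sections A)) (p : Sections A) :
    Submodule ℂ (Sections A) :=
  ⨅ F ∈ MvPolynomial.vanishingIdeal ℂ Z,
    LinearMap.ker (∑ α : A, MvPolynomial.eval p (MvPolynomial.pderiv α F) •
      (LinearMap.proj α : Sections A →ₗ[ℂ] ℂ))

/-! ### Pencils -/

/-- The Grassmannian of planes in `ℂ^A`. -/
def Gr2 (A : Finset (Fin d → ℤ)) : Type :=
  {W : Submodule ℂ (Sections A) // Module.finrank ℂ W = 2}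

/-- Ordered bases of planes in `ℂ^A`. -/
abbrev Frame2 (A : Finset (Fin d → ℤ)) : Type :=
  {b : Fin 2 → Sections A // LinearIndependent ℂ b}

/-- The plane spanned by a frame. -/
def Gr2.ofFrame {A : Finset (Fin d → ℤ)} (b : Frame2 A) : Gr2 A :=
  ⟨Submodule.span ℂ (Set.range b.1), by simpa using finrank_span_eq_card b.2⟩

/-- The usual topology of the Grassmannian, as a quotient of the space of frames. -/
instance (A : Finset (Fin d → ℤ)) : TopologicalSpace (Gr2 A) :=
  TopologicalSpace.coinduced Gr2.ofFrame inferInstance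

/-- The translate `t W` of a plane by `t ∈ (ℂ^*)^{d+1}`. -/
def Gr2.translate {A : Finset (Fin d → ℤ)} (t : BigTorus d) (W : Gr2 A) : Gr2 A :=
  ⟨W.1.map (torusEquiv A t : Sections A →ₗ[ℂ] Sections A), by
    rw [LinearEquiv.finrank_map_eq]; exact W.2⟩

/-- The part `∑_{α ∈ A'} c_α s_α` of the section `∑_{α ∈ A} c_α s_α`. -/
def partOn {A : Finset (Fin d → ℤ)} (A' : Finset (Fin d → ℤ)) (s : Sections A) : Sections A :=
  fun α => if (α : Fin d → ℤ) ∈ A' then s α else 0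

/-- The space of `A'`-sharpened pencils: planes with a basis `s_1, s_∞`, where
`s_1 = ∑_{α ∈ A} c_α s_α` is very full and `s_∞ = ∑_{α ∈ A'} c_α s_α`. -/
def sharpenedPencils (A A' : Finset (Fin d → ℤ)) : Set (Gr2 A) :=
  {W | ∃ s : Sections A, VeryFull s ∧ LinearIndependent ℂ ![s, partOn A' s] ∧
    W.1 = Submodule.span ℂ {s, partOn A' s}}

/-- The orbit `z ↦ γ(z) · s` of a section under the one parameter group
`γ = ∑_{α ∈ A'} e_α^∨`. When `s` is a very full section of a sharpened pencil `W`, this is an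
equivariant map `i_W : ℂ^* → W`; every such map arises from exactly one `s`. -/
def orbitMap {A : Finset (Fin d → ℤ)} (A' : Finset (Fin d → ℤ)) (s : Sections A) (z : ℂˣ) :
    Sections A :=
  fun α => if (α : Fin d → ℤ) ∈ A' then (z : ℂ) * s α else s α

/-- The set `i_W⁻¹(𝓔_A) ⊂ ℂ^*` for `i_W(z) = γ(z) · s`. -/
def critSet {A : Finset (Fin d → ℤ)} (A' : Finset (Fin d → ℤ)) (s : Sections A) : Set ℂˣ :=
  {z | orbitMap A' s z ∈ detLocus A}

/-- The space `V_{A,A'}` of `A'`-sharpened pencils `W` transverse to `𝓔_A`: at each point `p` of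
`i_W(ℂ^*) ∩ 𝓔_A`, that is at each very full section `p` in `W ∩ 𝓔_A`, the hypersurface `𝓔_A` is
smooth and `T_p W + T_p 𝓔_A = ℂ^A`. -/
def transversePencils (A A' : Finset (Fin d → ℤ)) : Set (Gr2 A) :=
  {W | W ∈ sharpenedPencils A A' ∧ ∀ p ∈ W.1, VeryFull p → p ∈ detLocus A →
    zariskiTangent (detLocus A) p ≠ ⊤ ∧ W.1 ⊔ zariskiTangent (detLocus A) p = ⊤}

/-- The pencils in `V_{A,A'}` for which `i_W⁻¹(𝓔_A)` has exactly `r` points. -/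
def transversePencilsWith (A A' : Finset (Fin d → ℤ)) (r : ℕ) : Set (Gr2 A) :=
  {W | W ∈ transversePencils A A' ∧
    ∀ s ∈ W.1, VeryFull s → (critSet A' s).encard = r}

/-- Two pencils are equivalent if they differ by an element of `(ℂ^*)^{d+1}`. -/
def pencilSetoid (A A' : Finset (Fin d → ℤ)) (r : ℕ) :
    Setoid (transversePencilsWith A A' r) where
  r W W' := ∃ t : BigTorus d, W'.1 = W.1.translate t
  iseqv := by
    have one : ∀ W : Gr2 A, W.translate (1 : BigTorus d) = W := by
      intro W
      apply Subtype.ext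
      have : ((torusEquiv A (1 : BigTorus d) : Sections A ≃ₗ[ℂ] Sections A) :
          Sections A →ₗ[ℂ] Sections A) = LinearMap.id := by
        ext s α
        simp [torusEquiv, monomialAt, LinearEquiv.smulOfUnit]
      simp [Gr2.translate, this]
    have mul : ∀ (t u : BigTorus d) (W : Gr2 A),
        (W.translate t).translate u = W.translate (u * t) := by
      intro t u W
      apply Subtype.ext
      have : ((torusEquiv A (u * t) : Sections A ≃ₗ[ℂ] Sections A) :
          Sections A →ₗ[ℂ] Sections A) =
          (torusEquiv A u : Sections A →ₗ[ℂ] Sections A) ∘ₗ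
            (torusEquiv A t : Sections A →ₗ[ℂ] Sections A) := by
        refine LinearMap.ext fun s => funext fun α => ?_
        have hm : monomialAt (u.2 * t.2) (α : Fin d → ℤ) =
            monomialAt u.2 (α : Fin d → ℤ) * monomialAt t.2 (α : Fin d → ℤ) := by
          simp [monomialAt, mul_zpow, Finset.prod_mul_distrib]
        change ((u.1 * t.1) * monomialAt (u.2 * t.2) (α : Fin d → ℤ)) • s α =
          (u.1 * monomialAt u.2 (α : Fin d → ℤ)) •
            ((t.1 * monomialAt t.2 (α : Fin d → ℤ)) • s α)
        rw [hm, smul_smul, mul_mul_mul_comm]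
      simp only [Gr2.translate]
      rw [this, Submodule.map_comp]
    refine ⟨fun W => ⟨1, (one _).symm⟩, ?_, ?_⟩
    · rintro W W' ⟨t, ht⟩
      exact ⟨t⁻¹, by rw [ht, mul, inv_mul_cancel, one]⟩
    · rintro W W' W'' ⟨t, ht⟩ ⟨u, hu⟩
      exact ⟨u * t, by rw [hu, ht, mul]⟩

/-- The quotient by `(ℂ^*)^{d+1}` of the space of transverse pencils with `r` points, with the
quotient topology. -/
abbrev PencilQuotient (A A' : Finset (Fin d → ℤ)) (r : ℕ) : Type :=
  Quotient (pencilSetoid A A' r)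

/-! ### Configurations of points -/

/-- Tuples that agree up to a permutation of the indices. -/
def permSetoid (r : ℕ) : Setoid (Fin r → ℂˣ) where
  r x y := ∃ σ : Equiv.Perm (Fin r), y = x ∘ σ
  iseqv := by
    refine ⟨fun x => ⟨1, rfl⟩, ?_, ?_⟩
    · rintro x y ⟨σ, rfl⟩
      exact ⟨σ⁻¹, by funext j; simp⟩
    · rintro x y z ⟨σ, rfl⟩ ⟨τ, rfl⟩
      exact ⟨σ * τ, rfl⟩

/-- The space `E_r = (ℂ^*)^r / 𝔖_r` of `r` unmarked points in `ℂ^*`, with the quotient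
topology. -/
abbrev Config (r : ℕ) : Type := Quotient (permSetoid r)

/-- Tuples that agree up to a permutation of the indices and a common factor in `ℂ^*`. -/
def scaleSetoid (r : ℕ) : Setoid (Config r) where
  r P P' := ∃ z : ℂˣ, ∃ x : Fin r → ℂˣ,
    P = Quotient.mk _ x ∧ P' = Quotient.mk _ (fun j => z * x j)
  iseqv := by
    refine ⟨?_, ?_, ?_⟩
    · intro P
      induction P using Quotient.inductionOn with
      | h x => exact ⟨1, x, rfl, by simp⟩
    · rintro P P' ⟨z, x, rfl, rfl⟩
      exact ⟨z⁻¹, fun j => z * x j, rfl, by simp⟩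
    · rintro P P' P'' ⟨z, x, rfl, hP'⟩ ⟨w, y, hy, rfl⟩
      obtain ⟨σ, hσ⟩ := Quotient.exact (hP'.symm.trans hy)
      refine ⟨w * z, x, rfl, Quotient.sound ⟨σ⁻¹, ?_⟩⟩
      funext j
      simp [hσ, mul_assoc]

/-- The quotient `E_r / ℂ^*` by the multiplication action, with the quotient topology. -/
abbrev ScaledConfig (r : ℕ) : Type := Quotient (scaleSetoid r)

/-- The point of `E_r` given by a set of exactly `r` points in `ℂ^*`. -/
def configOfSet {r : ℕ} (S : Set ℂˣ) (hS : S.encard = r) : Config r :=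
  Quotient.mk _ fun j : Fin r =>
    (((haveI : Finite S := Set.finite_of_encard_eq_coe hS
      Finite.equivFinOfCardEq (α := S) (n := r)
        (by rw [Nat.card_coe_set_eq, ← ENat.natCast_inj, (Set.finite_of_encard_eq_coe hS).cast_ncard_eq,
          hS])).symm j : S) : ℂˣ)

/-- A choice, for each pencil `W` under consideration, of a very full section `s` of `W`, or
equivalently of the equivariant map `i_W(z) = γ(z) · s`. -/
abbrev OrbitChoice (A A' : Finset (Fin d → ℤ)) (r : ℕ) : Type :=
  {i : transversePencilsWith A A' r → Sections A // ∀ W, i W ∈ W.1.1 ∧ VeryFull (i W)}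

/-- The map `𝐜(W) = i_W⁻¹(𝓔_A)` into `E_r`. -/
def critMap {A A' : Finset (Fin d → ℤ)} {r : ℕ} (i : OrbitChoice A A' r)
    (W : transversePencilsWith A A' r) : Config r :=
  configOfSet (critSet A' (i.1 W)) (W.2.2 _ (i.2 W).1 (i.2 W).2)

end SharpenedPencil

end

open SharpenedPencil

namespace SharpenedPencil

variable {d : ℕ} {A A' : Finset (Fin d → ℤ)}

/-! ### Torus invariance of the determinant locus -/

/-! The set of tuples with a common zero is stable under the torus, so its vanishing ideal,
generated by `R_A`, is stable too. Hence `𝓔_A` is torus-invariant, and in particular a cone. This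
gives invariance of the pencil spaces.

In a sharpened pencil the very full sections form one orbit of scalars and `γ`
(`exists_eq_smul_orbitMap`). Changing `s` therefore multiplies the critical set by a constant: its
cardinality and its class modulo `ℂ^*` are intrinsic. An infinite critical set would put a whole
line, and by scaling the plane `W`, in the tangent space at a smooth point, against transversality
(`critSet_finite`).

Continuity of `𝐜` is Hurwitz's theorem plus counting: the `r` distinct roots persist nearby, and as
there are exactly `r`, no others appear (`continuousAt_configOfSet`). For `𝐜̃`, the frame space is
an open quotient cover of the Grassmannian on which continuous very full sections exist locally; the
class does not see the choice of section. -/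

theorem torusEquiv_apply (t : BigTorus d) (s : Sections A) (α : A) :
    torusEquiv A t s α = ((t.1 * monomialAt t.2 (α : Fin d → ℤ) : ℂˣ) : ℂ) * s α := rfl

theorem monomialAt_mul (x y : Fin d → ℂˣ) (α : Fin d → ℤ) :
    monomialAt (x * y) α = monomialAt x α * monomialAt y α := by
  simp [monomialAt, mul_zpow, Finset.prod_mul_distrib]

theorem monomialAt_inv (x : Fin d → ℂˣ) (α : Fin d → ℤ) :
    monomialAt x⁻¹ α = (monomialAt x α)⁻¹ := by
  simp [monomialAt]

theorem torusEquiv_inv_apply (t : BigTorus d) (s : Sections A) :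
    torusEquiv A t⁻¹ (torusEquiv A t s) = s := by
  funext α
  simp only [torusEquiv_apply, Prod.fst_inv, Prod.snd_inv, monomialAt_inv]
  rw [← mul_assoc, ← Units.val_mul, ← mul_inv, inv_mul_cancel, Units.val_one, one_mul]

theorem eval_aeval_C_mul_X {σ : Type*} (u p : σ → ℂ) (F : MvPolynomial σ ℂ) :
    MvPolynomial.eval p
      (MvPolynomial.aeval (fun α => MvPolynomial.C (u α) * MvPolynomial.X α) F) =
      MvPolynomial.eval (fun α => u α * p α) F := by
  induction F using MvPolynomial.induction_on with
  | C a => simp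
  | add P Q hP hQ => rw [map_add, map_add, hP, hQ, map_add]
  | mul_X P i hP => rw [map_mul, map_mul, hP, map_mul]; simp

/-- Twisting coefficients by `η^α` moves a common zero `x` to `η⁻¹x`; the factor `λ` is harmless. -/
theorem commonZeroTuples_torus (t : BigTorus d) {F : Fin (d + 1) × A → ℂ}
    (hF : F ∈ commonZeroTuples A) :
    (fun jα => ((t.1 * monomialAt t.2 (jα.2 : Fin d → ℤ) : ℂˣ) : ℂ) * F jα) ∈
      commonZeroTuples A := by
  obtain ⟨x, hx⟩ := hF
  refine ⟨t.2⁻¹ * x, fun j => ?_⟩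
  have h : laurentEval (fun α : A =>
      ((t.1 * monomialAt t.2 (α : Fin d → ℤ) : ℂˣ) : ℂ) * F (j, α)) (t.2⁻¹ * x) =
      (t.1 : ℂ) * laurentEval (fun α : A => F (j, α)) x := by
    simp only [laurentEval, Finset.mul_sum, monomialAt_mul, monomialAt_inv, Units.val_mul]
    refine Finset.sum_congr rfl fun α _ => ?_
    have := (monomialAt t.2 (α : Fin d → ℤ)).mul_inv
    linear_combination (t.1 : ℂ) * F (j, α) * (monomialAt x (α : Fin d → ℤ) : ℂ) * this
  rw [h, hx j, mul_zero]

/-- The substituted resultant still lies in the vanishing ideal, so it is a multiple of `aResultant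
A`. With the default value `0` there is nothing to prove. -/
theorem aResultant_eval_torus (t : BigTorus d) {F : Fin (d + 1) × A → ℂ}
    (hF : MvPolynomial.eval F (aResultant A) = 0) :
    MvPolynomial.eval
      (fun jα => ((t.1 * monomialAt t.2 (jα.2 : Fin d → ℤ) : ℂˣ) : ℂ) * F jα)
      (aResultant A) = 0 := by
  by_cases h : ∃ R : MvPolynomial (Fin (d + 1) × A) ℂ,
      MvPolynomial.vanishingIdeal ℂ (commonZeroTuples A) = Ideal.span {R}
  · have hR : MvPolynomial.vanishingIdeal ℂ (commonZeroTuples A) =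
        Ideal.span {aResultant A} := by
      rw [aResultant, dif_pos h]
      exact h.choose_spec
    rw [← eval_aeval_C_mul_X]
    have hmem : aResultant A ∈ MvPolynomial.vanishingIdeal ℂ (commonZeroTuples A) :=
      hR ▸ Ideal.mem_span_singleton_self _
    have hmem' : MvPolynomial.aeval (fun jα : Fin (d + 1) × A => MvPolynomial.C
        ((t.1 * monomialAt t.2 (jα.2 : Fin d → ℤ) : ℂˣ) : ℂ) * MvPolynomial.X jα)
        (aResultant A) ∈ MvPolynomial.vanishingIdeal ℂ (commonZeroTuples A) := by
      intro G hG
      rw [MvPolynomial.aeval_eq_eval, eval_aeval_C_mul_X]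
      exact hmem _ (commonZeroTuples_torus t hG)
    rw [hR, Ideal.mem_span_singleton] at hmem'
    obtain ⟨Q, hQ⟩ := hmem'
    rw [hQ, map_mul, hF, zero_mul]
  · simp [aResultant, dif_neg h]

theorem mem_detLocus_iff (s : Sections A) :
    s ∈ detLocus A ↔ MvPolynomial.eval
      (fun jα : Fin (d + 1) × A => ((homogenized (jα.2 : Fin d → ℤ) jα.1 : ℤ) : ℂ) * s jα.2)
      (aResultant A) = 0 := by
  rw [detLocus, Set.mem_ofPred_eq, principalDeterminant]
  suffices ∀ R : MvPolynomial (Fin (d + 1) × A) ℂ, MvPolynomial.eval s (MvPolynomial.aeval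
      (fun jα : Fin (d + 1) × A => MvPolynomial.C
        ((homogenized (jα.2 : Fin d → ℤ) jα.1 : ℤ) : ℂ) * MvPolynomial.X jα.2) R) =
      MvPolynomial.eval
      (fun jα => ((homogenized (jα.2 : Fin d → ℤ) jα.1 : ℤ) : ℂ) * s jα.2) R by
    rw [this]
  intro R
  induction R using MvPolynomial.induction_on with
  | C a => simp
  | add P Q hP hQ => rw [map_add, map_add, hP, hQ, map_add]
  | mul_X P i hP => rw [map_mul, map_mul, hP, map_mul]; simp

theorem torusEquiv_mem_detLocus (t : BigTorus d) {s : Sections A} (hs : s ∈ detLocus A) :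
    torusEquiv A t s ∈ detLocus A := by
  rw [mem_detLocus_iff] at hs ⊢
  -- The torus acts diagonally, so it commutes with passing from `f` to its logarithmic derivatives.
  convert aResultant_eval_torus t hs using 3
  funext jα
  rw [torusEquiv_apply]
  ring

theorem torusEquiv_mem_detLocus_iff (t : BigTorus d) (s : Sections A) :
    torusEquiv A t s ∈ detLocus A ↔ s ∈ detLocus A :=
  ⟨fun h => by simpa only [torusEquiv_inv_apply] using torusEquiv_mem_detLocus t⁻¹ h,
    torusEquiv_mem_detLocus t⟩

theorem smul_mem_detLocus_iff (a : ℂˣ) (s : Sections A) :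
    (a : ℂ) • s ∈ detLocus A ↔ s ∈ detLocus A := by
  rw [← torusEquiv_mem_detLocus_iff (a, 1) s]
  have : torusEquiv A (a, 1) s = (a : ℂ) • s := by
    funext α
    simp [torusEquiv_apply, monomialAt]
  rw [this]

/-! ### Tangent spaces -/

theorem hasDerivAt_eval_line {σ : Type*} [Fintype σ] (F : MvPolynomial σ ℂ) (p v : σ → ℂ) :
    HasDerivAt (fun z : ℂ => MvPolynomial.eval (p + z • v) F)
      (∑ α, MvPolynomial.eval p (MvPolynomial.pderiv α F) * v α) 0 := by
  classical
  induction F using MvPolynomial.induction_on with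
  | C a => simpa using hasDerivAt_const (0 : ℂ) a
  | add P Q hP hQ => 
    simp only [map_add, add_mul, Finset.sum_add_distrib]
    exact hP.add hQ
  | mul_X P i hP =>
    have hX : HasDerivAt (fun z : ℂ => MvPolynomial.eval (p + z • v) (MvPolynomial.X i))
        (v i) 0 := by
      simpa using ((hasDerivAt_id (0 : ℂ)).mul_const (v i)).const_add (p i)
    have h := hP.mul hX
    have he : (∑ α, MvPolynomial.eval p (MvPolynomial.pderiv α (P * MvPolynomial.X i)) * v α) =
        (∑ α, MvPolynomial.eval p (MvPolynomial.pderiv α P) * v α) * p i +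
          MvPolynomial.eval p P * v i := by
      simp only [MvPolynomial.pderiv_mul, MvPolynomial.pderiv_X, map_add, map_mul,
        MvPolynomial.eval_X, add_mul, Finset.sum_add_distrib, Finset.sum_mul]
      congr 1
      · exact Finset.sum_congr rfl fun α _ => by ring
      · rw [Finset.sum_eq_single i]
        · simp
        · intro α _ hα
          simp [hα.symm]
        · simp
    rw [he]
    simp only [map_mul, MvPolynomial.eval_X]
    simp only [zero_smul, add_zero, MvPolynomial.eval_X] at h
    exact h

/-- Tangency read off along lines: this form transports under linear maps without computing partial
derivatives. -/
theorem mem_zariskiTangent_iff {Z : Set (Sections A)} {p v : Sections A} :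
    v ∈ zariskiTangent Z p ↔ ∀ F ∈ MvPolynomial.vanishingIdeal ℂ Z,
      HasDerivAt (fun z : ℂ => MvPolynomial.eval (p + z • v) F) 0 0 := by
  simp only [zariskiTangent, Submodule.mem_iInf, LinearMap.mem_ker, LinearMap.sum_apply,
    LinearMap.smul_apply, LinearMap.proj_apply, smul_eq_mul]
  refine forall₂_congr fun F _ => ⟨fun h => h ▸ hasDerivAt_eval_line F p v, fun h => ?_⟩
  exact (hasDerivAt_eval_line F p v).unique h

/-- A vector is tangent to `Z` at `p` if the points `p + z v` with small `z` belong to `Z`. -/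
theorem mem_zariskiTangent_of_eventually {Z : Set (Sections A)} {p v : Sections A}
    (h : ∀ᶠ z : ℂ in 𝓝 0, p + z • v ∈ Z) : v ∈ zariskiTangent Z p := by
  rw [mem_zariskiTangent_iff]
  intro F hF
  refine (hasDerivAt_const (0 : ℂ) (0 : ℂ)).congr_of_eventuallyEq ?_
  filter_upwards [h] with z hz
  simpa [MvPolynomial.coe_aeval_eq_eval] using hF _ hz

theorem torusEquiv_mem_zariskiTangent (t : BigTorus d) {p v : Sections A}
    (hv : v ∈ zariskiTangent (detLocus A) p) :
    torusEquiv A t v ∈ zariskiTangent (detLocus A) (torusEquiv A t p) := by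
  rw [mem_zariskiTangent_iff] at hv ⊢
  intro F hF
  set u : A → ℂ := fun α => ((t.1 * monomialAt t.2 (α : Fin d → ℤ) : ℂˣ) : ℂ)
  have he : ∀ s : Sections A, MvPolynomial.eval s
      (MvPolynomial.aeval (fun α => MvPolynomial.C (u α) * MvPolynomial.X α) F) =
      MvPolynomial.eval (torusEquiv A t s) F := fun s => eval_aeval_C_mul_X u s F
  -- The pullback of `F` along `t` again vanishes on the invariant locus, so it may test `v`.
  have := hv (MvPolynomial.aeval (fun α => MvPolynomial.C (u α) * MvPolynomial.X α) F) (by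
    intro s hs
    rw [MvPolynomial.aeval_eq_eval, he]
    exact hF _ (torusEquiv_mem_detLocus t hs))
  simpa only [he, map_add, map_smul] using this

theorem torusEquiv_mem_zariskiTangent_iff (t : BigTorus d) {p v : Sections A} :
    torusEquiv A t v ∈ zariskiTangent (detLocus A) (torusEquiv A t p) ↔
      v ∈ zariskiTangent (detLocus A) p :=
  ⟨fun h => by simpa only [torusEquiv_inv_apply] using torusEquiv_mem_zariskiTangent t⁻¹ h,
    torusEquiv_mem_zariskiTangent t⟩

theorem map_zariskiTangent (t : BigTorus d) (p : Sections A) :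
    (zariskiTangent (detLocus A) p).map (torusEquiv A t : Sections A →ₗ[ℂ] Sections A) =
      zariskiTangent (detLocus A) (torusEquiv A t p) := by
  ext v
  obtain ⟨w, rfl⟩ := (torusEquiv A t).surjective v
  rw [torusEquiv_mem_zariskiTangent_iff]
  exact Submodule.map_equiv_eq_comap_symm (torusEquiv A t) (zariskiTangent (detLocus A) p) ▸
    by simp

/-! ### Critical sets of sharpened pencils -/

theorem orbitMap_eq (s : Sections A) (z : ℂˣ) :
    orbitMap A' s z = s + ((z : ℂ) - 1) • partOn A' s := by
  funext α
  by_cases h : (α : Fin d → ℤ) ∈ A' <;> simp [orbitMap, partOn, h]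
  ring

theorem orbitMap_orbitMap (s : Sections A) (z w : ℂˣ) :
    orbitMap A' (orbitMap A' s w) z = orbitMap A' s (z * w) := by
  funext α
  by_cases h : (α : Fin d → ℤ) ∈ A' <;> simp [orbitMap, h, mul_assoc]

theorem orbitMap_smul (s : Sections A) (a : ℂ) (z : ℂˣ) :
    orbitMap A' (a • s) z = a • orbitMap A' s z := by
  funext α
  by_cases h : (α : Fin d → ℤ) ∈ A' <;> simp [orbitMap, h]
  ring

theorem orbitMap_torusEquiv (t : BigTorus d) (s : Sections A) (z : ℂˣ) :
    orbitMap A' (torusEquiv A t s) z = torusEquiv A t (orbitMap A' s z) := by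
  funext α
  by_cases h : (α : Fin d → ℤ) ∈ A' <;> simp [orbitMap, torusEquiv_apply, h]
  ring

theorem partOn_torusEquiv (t : BigTorus d) (s : Sections A) :
    partOn A' (torusEquiv A t s) = torusEquiv A t (partOn A' s) := by
  funext α
  by_cases h : (α : Fin d → ℤ) ∈ A' <;> simp [partOn, torusEquiv_apply, h]

theorem critSet_torusEquiv (t : BigTorus d) (s : Sections A) :
    critSet A' (torusEquiv A t s) = critSet A' s := by
  ext z
  simp only [critSet, Set.mem_ofPred_eq, orbitMap_torusEquiv, torusEquiv_mem_detLocus_iff]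

theorem mem_critSet_smul_orbitMap (s : Sections A) (a w z : ℂˣ) :
    z ∈ critSet A' ((a : ℂ) • orbitMap A' s w) ↔ z * w ∈ critSet A' s := by
  simp only [critSet, Set.mem_ofPred_eq, orbitMap_smul, orbitMap_orbitMap, smul_mem_detLocus_iff]

theorem VeryFull.torusEquiv {s : Sections A} (hs : VeryFull s) (t : BigTorus d) :
    VeryFull (torusEquiv A t s) :=
  fun α => by rw [torusEquiv_apply]; exact mul_ne_zero (Units.ne_zero _) (hs α)

/-- Very full sections of a sharpened pencil lie in one orbit of `ℂ^* × γ(ℂ^*)`. -/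
theorem exists_eq_smul_orbitMap (hA' : A' ⊂ A) {W : Gr2 A} (hW : W ∈ sharpenedPencils A A') :
    ∃ s ∈ W.1, VeryFull s ∧
      W.1 = Submodule.span ℂ {s, partOn A' s} ∧
      ∀ s' ∈ W.1, VeryFull s' → ∃ a w : ℂˣ, s' = (a : ℂ) • orbitMap A' s w := by
  obtain ⟨s, hs, hli, hspan⟩ := hW
  refine ⟨s, hspan ▸ Submodule.subset_span (by simp), hs, hspan, ?_⟩
  intro s' hs' hvf
  rw [hspan, Submodule.mem_span_pair] at hs'
  obtain ⟨a, b, rfl⟩ := hs'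
  obtain ⟨α, hαA, hα⟩ := Finset.exists_of_ssubset hA'
  -- Relative to `s`, coefficients outside `A'` are scaled by `a`, those in `A'` by `a + b`. Both
  -- kinds of exponent occur, so both factors are nonzero, and `w` is their ratio.
  have ha : a ≠ 0 := by
    rintro rfl
    exact hvf ⟨α, hαA⟩ (by simp [partOn, hα])
  have hne : partOn A' s ≠ 0 := by simpa using hli.ne_zero 1
  obtain ⟨β, hβ⟩ := Function.ne_iff.1 hne
  have hβ' : (β : Fin d → ℤ) ∈ A' := by
    by_contra h
    exact hβ (by simp [partOn, h])
  have hab : a + b ≠ 0 := by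
    intro h
    refine hvf β ?_
    simp [partOn, hβ', ← add_mul, h]
  refine ⟨Units.mk0 a ha, Units.mk0 ((a + b) / a) (div_ne_zero hab ha), ?_⟩
  funext γ
  by_cases h : (γ : Fin d → ℤ) ∈ A' <;> simp [orbitMap, partOn, h]
  field_simp

/-- The scalar is invisible to the cone `𝓔_A`, and `γ(w)` only shifts the parameter. -/
theorem exists_mem_critSet_iff (hA' : A' ⊂ A) {W : Gr2 A} (hW : W ∈ sharpenedPencils A A')
    {s s' : Sections A} (hs : s ∈ W.1) (hvs : VeryFull s) (hs' : s' ∈ W.1)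
    (hvs' : VeryFull s') :
    ∃ w : ℂˣ, ∀ z, w * z ∈ critSet A' s' ↔ z ∈ critSet A' s := by
  obtain ⟨s₀, -, -, -, h⟩ := exists_eq_smul_orbitMap hA' hW
  obtain ⟨a, u, rfl⟩ := h s hs hvs
  obtain ⟨b, v, rfl⟩ := h s' hs' hvs'
  refine ⟨u * v⁻¹, fun z => ?_⟩
  rw [mem_critSet_smul_orbitMap, mem_critSet_smul_orbitMap]
  congr! 1
  rw [mul_right_comm, inv_mul_cancel_right, mul_comm]

theorem encard_eq_of_mem_mul_iff {S S' : Set ℂˣ} {w : ℂˣ} (h : ∀ z, w * z ∈ S' ↔ z ∈ S) :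
    S'.encard = S.encard := by
  have : S = (fun z => w * z) ⁻¹' S' := Set.ext fun z => (h z).symm
  rw [this, Set.encard_preimage_of_bijective (Group.mulLeft_bijective w)]

theorem encard_critSet_eq (hA' : A' ⊂ A) {W : Gr2 A} (hW : W ∈ sharpenedPencils A A')
    {s s' : Sections A} (hs : s ∈ W.1) (hvs : VeryFull s) (hs' : s' ∈ W.1)
    (hvs' : VeryFull s') : (critSet A' s').encard = (critSet A' s).encard := by
  obtain ⟨w, hw⟩ := exists_mem_critSet_iff hA' hW hs hvs hs' hvs'
  exact encard_eq_of_mem_mul_iff hw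

/-- The restriction of the principal `A`-determinant to the line `s + (z - 1) s_∞`. -/
theorem exists_polynomial_eval_line {σ : Type*} (F : MvPolynomial σ ℂ) (p v : σ → ℂ) :
    ∃ q : Polynomial ℂ, ∀ z, q.eval z = MvPolynomial.eval (p + (z - 1) • v) F := by
  refine ⟨MvPolynomial.aeval
    (fun α => Polynomial.C (p α) + (Polynomial.X - 1) * Polynomial.C (v α)) F, fun z => ?_⟩
  induction F using MvPolynomial.induction_on with
  | C a => simp
  | add P Q hP hQ => simp [hP, hQ]
  | mul_X P i hP => simp [hP]

/-- If the critical set is infinite, the whole line `s + (z - 1) s_∞` is in the determinant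
locus. -/
theorem mem_detLocus_of_infinite {s : Sections A} (h : (critSet A' s).Infinite) (z : ℂ) :
    s + (z - 1) • partOn A' s ∈ detLocus A := by
  obtain ⟨q, hq⟩ := exists_polynomial_eval_line (principalDeterminant A) s (partOn A' s)
  have hinf : {z : ℂ | q.IsRoot z}.Infinite := by
    refine (h.image Units.val_injective.injOn).mono ?_
    rintro _ ⟨z, hz, rfl⟩
    rw [critSet, Set.mem_ofPred_eq, orbitMap_eq] at hz
    exact (hq z).trans hz
  rw [detLocus, Set.mem_ofPred_eq, ← hq, Polynomial.eq_zero_of_infinite_isRoot q hinf,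
    Polynomial.eval_zero]

/-- If infinite, both generators of `W` are tangent at `s₀`; then `W` adds nothing to the tangent
space, which must be everything, contradicting smoothness. -/
theorem critSet_finite (hA' : A' ⊂ A) {W : Gr2 A} (hW : W ∈ transversePencils A A')
    {s : Sections A} (hs : s ∈ W.1) (hvs : VeryFull s) : (critSet A' s).Finite := by
  obtain ⟨s₀, hs₀, hvs₀, hspan, -⟩ := exists_eq_smul_orbitMap hA' hW.1
  rw [← Set.encard_lt_top_iff, encard_critSet_eq hA' hW.1 hs₀ hvs₀ hs hvs,
    Set.encard_lt_top_iff]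
  by_contra hinf
  have hline := mem_detLocus_of_infinite (Set.not_finite.1 fun h => hinf h)
  have hmem : s₀ ∈ detLocus A := by simpa using hline 1
  obtain ⟨hne, htop⟩ := hW.2 s₀ hs₀ hvs₀ hmem
  refine hne (htop ▸ (sup_eq_right.2 ?_).symm)
  rw [hspan, Submodule.span_le, Set.insert_subset_iff, Set.singleton_subset_iff]
  refine ⟨mem_zariskiTangent_of_eventually ?_, mem_zariskiTangent_of_eventually ?_⟩
  -- Direction `s₀`: the points `(1 + z) s₀` stay in the cone as long as `1 + z ≠ 0`.
  · have hc : ContinuousAt (fun z : ℂ => 1 + z) 0 := by fun_prop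
    filter_upwards [hc.eventually_ne (y := 0) (by simp)] with z hz
    have := (smul_mem_detLocus_iff (Units.mk0 (1 + z) hz) s₀).2 hmem
    simpa [add_smul] using this
  · filter_upwards with z
    simpa using hline (z + 1)

/-! ### Torus invariance of the spaces of pencils -/

theorem translate_mem_sharpenedPencils (t : BigTorus d) {W : Gr2 A}
    (hW : W ∈ sharpenedPencils A A') : W.translate t ∈ sharpenedPencils A A' := by
  obtain ⟨s, hs, hli, hspan⟩ := hW
  refine ⟨torusEquiv A t s, hs.torusEquiv t, ?_, ?_⟩
  · have := hli.map' (torusEquiv A t : Sections A →ₗ[ℂ] Sections A) (LinearEquiv.ker _)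
    rw [partOn_torusEquiv]
    have he : ![torusEquiv A t s, torusEquiv A t (partOn A' s)] =
        (torusEquiv A t : Sections A →ₗ[ℂ] Sections A) ∘ ![s, partOn A' s] := by
      funext j
      fin_cases j <;> rfl
    rw [he]
    exact this
  · change Submodule.map (torusEquiv A t : Sections A →ₗ[ℂ] Sections A) W.1 = _
    rw [partOn_torusEquiv, hspan, Submodule.map_span, Set.image_pair]
    rfl

theorem exists_of_mem_translate {t : BigTorus d} {W : Gr2 A} {p : Sections A}
    (hp : p ∈ (W.translate t).1) (hvp : VeryFull p) :
    ∃ s ∈ W.1, VeryFull s ∧ torusEquiv A t s = p := by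
  obtain ⟨s, hs, rfl⟩ := hp
  refine ⟨s, hs, fun α hα => hvp α ?_, rfl⟩
  rw [LinearEquiv.coe_coe, torusEquiv_apply, hα, mul_zero]

theorem translate_mem_transversePencils (t : BigTorus d) {W : Gr2 A}
    (hW : W ∈ transversePencils A A') : W.translate t ∈ transversePencils A A' := by
  refine ⟨translate_mem_sharpenedPencils t hW.1, fun p hp hvp hdet => ?_⟩
  obtain ⟨s, hs, hvs, rfl⟩ := exists_of_mem_translate hp hvp
  obtain ⟨hne, htop⟩ := hW.2 s hs hvs ((torusEquiv_mem_detLocus_iff t s).1 hdet)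
  have hmt : (⊤ : Submodule ℂ (Sections A)).map
      (torusEquiv A t : Sections A →ₗ[ℂ] Sections A) = ⊤ := by
    rw [Submodule.map_top, LinearEquiv.range]
  rw [← map_zariskiTangent]
  refine ⟨fun h => hne ?_, ?_⟩
  · rw [← hmt] at h
    exact Submodule.map_injective_of_injective (torusEquiv A t).injective h
  · change Submodule.map (torusEquiv A t : Sections A →ₗ[ℂ] Sections A) W.1 ⊔ _ = _
    rw [← Submodule.map_sup, htop, hmt]

theorem translate_mem_transversePencilsWith (t : BigTorus d) {r : ℕ} {W : Gr2 A}
    (hW : W ∈ transversePencilsWith A A' r) : W.translate t ∈ transversePencilsWith A A' r := by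
  refine ⟨translate_mem_transversePencils t hW.1, fun p hp hvp => ?_⟩
  obtain ⟨s, hs, hvs, rfl⟩ := exists_of_mem_translate hp hvp
  rw [critSet_torusEquiv]
  exact hW.2 s hs hvs

theorem exists_mem_transversePencilsWith (hA' : A' ⊂ A) {W : Gr2 A}
    (hW : W ∈ transversePencils A A') : ∃ r : ℕ, W ∈ transversePencilsWith A A' r := by
  obtain ⟨s, hs, hvs, -⟩ := exists_eq_smul_orbitMap hA' hW.1
  refine ⟨(critSet A' s).ncard, hW, fun s' hs' hvs' => ?_⟩
  rw [encard_critSet_eq hA' hW.1 hs hvs hs' hvs', (critSet_finite hA' hW hs hvs).cast_ncard_eq]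

/-! ### Configurations -/

/-- Any `r` distinct points of an `r`-element set exhaust it, so the enumeration chosen in
`configOfSet` is immaterial. -/
theorem configOfSet_eq_mk {r : ℕ} {S : Set ℂˣ} (hS : S.encard = r) {x : Fin r → ℂˣ}
    (hx : Function.Injective x) (hmem : ∀ j, x j ∈ S) :
    configOfSet S hS = Quotient.mk (permSetoid r) x := by
  have : Finite S := Set.finite_of_encard_eq_coe hS
  have hcard : Nat.card S = r := by
    rw [Nat.card_coe_set_eq, Set.ncard, hS, ENat.toNat_natCast]
  have hinj : Function.Injective fun j => Finite.equivFinOfCardEq hcard ⟨x j, hmem j⟩ :=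
    fun j k h => hx (congrArg Subtype.val ((Finite.equivFinOfCardEq hcard).injective h))
  refine Quotient.sound
    ⟨Equiv.ofBijective _ (Finite.injective_iff_bijective.1 hinj), funext fun j => ?_⟩
  simp

theorem exists_configOfSet_eq_mk {r : ℕ} {S : Set ℂˣ} (hS : S.encard = r) :
    ∃ x : Fin r → ℂˣ, Function.Injective x ∧ (∀ j, x j ∈ S) ∧
      configOfSet S hS = Quotient.mk (permSetoid r) x :=
  ⟨_, fun _ _ h => Equiv.injective _ (Subtype.val_injective h), fun _ => Subtype.coe_prop _, rfl⟩

theorem mk_configOfSet_eq_of_mul {r : ℕ} {S S' : Set ℂˣ} (hS : S.encard = r)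
    (hS' : S'.encard = r) {w : ℂˣ} (h : ∀ z, w * z ∈ S' ↔ z ∈ S) :
    Quotient.mk (scaleSetoid r) (configOfSet S hS) =
      Quotient.mk (scaleSetoid r) (configOfSet S' hS') := by
  obtain ⟨x, hinj, hmem, hx⟩ := exists_configOfSet_eq_mk hS
  refine Quotient.sound ⟨w, x, hx, configOfSet_eq_mk hS' ?_ fun j => (h _).2 (hmem j)⟩
  exact fun j k hjk => hinj (mul_left_cancel hjk)

/-! ### Continuity of roots -/

/-- Hurwitz: an isolated zero of an entire function persists under small deformations. -/
theorem eventually_exists_zero_mem {X : Type*} [TopologicalSpace X] {f : X → ℂ → ℂ}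
    (hf : Continuous (Function.uncurry f)) (hd : ∀ x, Differentiable ℂ (f x)) {x₀ : X} {z₀ : ℂ}
    (h0 : f x₀ z₀ = 0) (hne : ∀ᶠ z in 𝓝[≠] z₀, f x₀ z ≠ 0) {U : Set ℂ} (hU : U ∈ 𝓝 z₀) :
    ∀ᶠ x in 𝓝 x₀, ∃ z ∈ U, f x z = 0 := by
  rw [eventually_nhdsWithin_iff] at hne
  obtain ⟨ρ, hρ, hball⟩ := Metric.nhds_basis_closedBall.mem_iff.1 (Filter.inter_mem hne hU)
  have hsphere : ∀ z ∈ Metric.sphere z₀ ρ, f x₀ z ≠ 0 := fun z hz =>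
    (hball (Metric.sphere_subset_closedBall hz)).1 (Metric.ne_of_mem_sphere hz hρ.ne')
  have hcompact : IsCompact (Metric.sphere z₀ ρ) := isCompact_sphere z₀ ρ
  have hnonempty : (Metric.sphere z₀ ρ).Nonempty := NormedSpace.sphere_nonempty.2 hρ.le
  obtain ⟨z₁, hz₁, hmin⟩ := hcompact.exists_isMinOn hnonempty
    (f := fun z => ‖f x₀ z‖) (hd x₀).continuous.norm.continuousOn
  set m := ‖f x₀ z₁‖
  have hmpos : 0 < m := norm_pos_iff.2 (hsphere z₁ hz₁)
  have hcont : Continuous fun p : X × ℂ => ‖f p.1 p.2 - f p.1 z₀‖ :=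
    (hf.sub (hf.comp (continuous_fst.prodMk continuous_const))).norm
  -- The quantitative open mapping theorem turns the bound `m / 2` on the circle into a disc of
  -- radius `m / 4` about `f x z₀` inside the image; it contains `0` once `‖f x z₀‖ < m / 4`.
  have h1 : ∀ᶠ x in 𝓝 x₀, ∀ z ∈ Metric.sphere z₀ ρ, m / 2 < ‖f x z - f x z₀‖ := by
    refine hcompact.eventually_forall_of_forall_eventually fun z hz => ?_
    refine hcont.continuousAt.eventually (lt_mem_nhds ?_)
    have : m ≤ ‖f x₀ z‖ := hmin hz
    simp only [h0, sub_zero]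
    linarith
  have h2 : ∀ᶠ x in 𝓝 x₀, ‖f x z₀‖ < m / 2 / 2 := by
    have hc : Continuous fun x => ‖f x z₀‖ :=
      (hf.comp (continuous_id.prodMk continuous_const)).norm
    refine hc.continuousAt.eventually (gt_mem_nhds ?_)
    simp only [h0, norm_zero]
    positivity
  filter_upwards [h1, h2] with x hx1 hx2
  -- Were `f x` locally constant, the identity theorem would make it constant, against the bound on
  -- the circle.
  have hfreq : ∃ᶠ z in 𝓝 z₀, f x z ≠ f x z₀ := by
    intro hev
    have heq : f x = fun _ => f x z₀ := AnalyticOnNhd.eq_of_eventuallyEq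
      (fun z _ => (hd x).analyticAt z) analyticOnNhd_const
      (hev.mono fun z hz => not_not.1 hz)
    have := hx1 z₁ hz₁
    rw [congrFun heq z₁, sub_self, norm_zero] at this
    linarith
  obtain ⟨z, hz, hz0⟩ := (hd x).diffContOnCl.ball_subset_image_closedBall hρ
    (fun z hz => (hx1 z hz).le) hfreq (show (0 : ℂ) ∈ Metric.ball (f x z₀) (m / 2 / 2) by
      rwa [mem_ball_iff_norm, zero_sub, norm_neg])
  exact ⟨z, (hball hz).2, hz0⟩

theorem continuous_partOn : Continuous (partOn (A := A) A') := by
  refine continuous_pi fun α => ?_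
  by_cases h : (α : Fin d → ℤ) ∈ A'
  · simpa only [partOn, h, if_true] using continuous_apply α
  · simpa only [partOn, h, if_false] using continuous_const

theorem eventually_exists_mem_critSet {X : Type*} [TopologicalSpace X] {s : X → Sections A}
    (hs : Continuous s) {x₀ : X} (hfin : (critSet A' (s x₀)).Finite) {z₀ : ℂˣ}
    (hz₀ : z₀ ∈ critSet A' (s x₀)) {U : Set ℂˣ} (hU : U ∈ 𝓝 z₀) :
    ∀ᶠ x in 𝓝 x₀, ∃ z ∈ U, z ∈ critSet A' (s x) := by
  set E := principalDeterminant A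
  set f : X → ℂ → ℂ := fun x z =>
    MvPolynomial.eval (s x + (z - 1) • partOn A' (s x)) E
  have hcrit : ∀ (x : X) (z : ℂˣ), z ∈ critSet A' (s x) ↔ f x z = 0 := fun x z => by
    rw [critSet, Set.mem_ofPred_eq, orbitMap_eq]; rfl
  have hcont : Continuous (Function.uncurry f) := by
    have hs' : Continuous fun p : X × ℂ => partOn A' (s p.1) :=
      continuous_partOn.comp (hs.comp continuous_fst)
    exact (MvPolynomial.continuous_eval E).comp ((hs.comp continuous_fst).add
      ((continuous_snd.sub continuous_const).smul hs'))
  have hpoly : ∀ x, ∃ q : Polynomial ℂ, ∀ z, q.eval z = f x z := fun x =>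
    exists_polynomial_eval_line E (s x) (partOn A' (s x))
  have hdiff : ∀ x, Differentiable ℂ (f x) := fun x => by
    obtain ⟨q, hq⟩ := hpoly x
    rw [← funext hq]
    exact q.differentiable
  obtain ⟨q, hq⟩ := hpoly x₀
  -- A zero polynomial would make every point of the infinite set `ℂ^*` critical; so the roots are
  -- isolated.
  have hq0 : q ≠ 0 := by
    rintro rfl
    have : Infinite ℂˣ := Infinite.of_injective
      (fun n : ℕ => Units.mk0 ((n : ℂ) + 1) (Nat.cast_add_one_ne_zero n))
      fun m n h => by simpa using congrArg Units.val h
    refine Set.infinite_univ (α := ℂˣ) (hfin.subset fun z _ => (hcrit x₀ z).2 ?_)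
    rw [← hq, Polynomial.eval_zero]
  have hne : ∀ᶠ z in 𝓝[≠] (z₀ : ℂ), f x₀ z ≠ 0 := by
    have hroots : {z | q.IsRoot z}.Finite := by
      by_contra h
      exact hq0 (Polynomial.eq_zero_of_infinite_isRoot q h)
    rw [eventually_nhdsWithin_iff]
    filter_upwards [(hroots.subset (Set.sdiff_subset (t := {(z₀ : ℂ)}))).isClosed.isOpen_compl.mem_nhds
      (show (z₀ : ℂ) ∈ _ by simp)] with z hz hzne h
    exact hz ⟨(hq z).trans h, hzne⟩
  filter_upwards [eventually_exists_zero_mem hcont hdiff ((hcrit x₀ z₀).1 hz₀) hne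
    (Units.isOpenEmbedding_val.image_mem_nhds.2 hU)] with x hx
  obtain ⟨_, ⟨z, hzU, rfl⟩, hz⟩ := hx
  exact ⟨z, hzU, (hcrit x z).2 hz⟩

theorem isOpen_setOf_injective {ι X : Type*} [Finite ι] [TopologicalSpace X] [T2Space X] :
    IsOpen {x : ι → X | Function.Injective x} := by
  have : {x : ι → X | Function.Injective x} =
      ⋂ (i : ι) (j : ι), {x | x i = x j → i = j} := by
    ext x
    simp [Function.Injective]
  rw [this]
  refine isOpen_iInter_of_finite fun i => isOpen_iInter_of_finite fun j => ?_
  by_cases h : i = j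
  · simp [h]
  · simpa [h] using isOpen_ne_fun (continuous_apply i) (continuous_apply j)

/-- Each root persists in its own neighbourhood, and injectivity of tuples is open; `r` distinct
nearby roots are then all of them. The hypothesis is local because the section used later is very
full only near the base point. -/
theorem continuousAt_configOfSet {X : Type*} [TopologicalSpace X] {r : ℕ} {s : X → Sections A}
    (hs : Continuous s) {g : X → Config r} {x₀ : X}
    (hg : ∀ᶠ x in 𝓝 x₀, ∃ h : (critSet A' (s x)).encard = r,
      g x = configOfSet (critSet A' (s x)) h) :
    ContinuousAt g x₀ := by
  obtain ⟨h₀, hg₀⟩ := hg.self_of_nhds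
  obtain ⟨y₀, hinj, hmem, hy₀⟩ := exists_configOfSet_eq_mk h₀
  intro N hN
  rw [hg₀, hy₀] at hN
  have hN' : Quotient.mk (permSetoid r) ⁻¹' N ∩ {x | Function.Injective x} ∈ 𝓝 y₀ :=
    Filter.inter_mem (continuous_quotient_mk'.continuousAt hN)
      (isOpen_setOf_injective.mem_nhds hinj)
  rw [nhds_pi, Filter.mem_pi] at hN'
  obtain ⟨I, -, t, ht, htN⟩ := hN'
  have hroots : ∀ᶠ x in 𝓝 x₀, ∀ j, ∃ z ∈ t j, z ∈ critSet A' (s x) :=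
    Filter.eventually_all.2 fun j => eventually_exists_mem_critSet hs
      (Set.finite_of_encard_eq_coe h₀) (hmem j) (ht j)
  rw [Filter.mem_map]
  filter_upwards [hroots, hg] with x hx hgx
  choose y hyt hy using hx
  obtain ⟨h, hgx⟩ := hgx
  obtain ⟨hyN, hyinj⟩ := htN (fun j _ => hyt j : y ∈ I.pi t)
  rw [Set.mem_preimage, hgx, configOfSet_eq_mk h hyinj hy]
  exact hyN

theorem continuous_critMap {r : ℕ} (i : OrbitChoice A A' r) (hi : Continuous i.1) :
    Continuous (critMap i) :=
  continuous_iff_continuousAt.2 fun _ => continuousAt_configOfSet hi <|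
    Filter.Eventually.of_forall fun _ => ⟨_, rfl⟩

/-! ### The Grassmannian as an open quotient of the space of frames -/

theorem Gr2.ofFrame_surjective : Function.Surjective (Gr2.ofFrame (A := A)) := by
  rintro ⟨W, hW⟩
  have : Module.Finite ℂ W := Module.finite_of_finrank_eq_succ hW
  let b := Module.finBasisOfFinrankEq ℂ W hW
  refine ⟨⟨fun j => b j, b.linearIndependent.map' W.subtype W.ker_subtype⟩, Subtype.ext ?_⟩
  change Submodule.span ℂ (Set.range (W.subtype ∘ b)) = W
  rw [Set.range_comp, ← Submodule.map_span, b.span_eq, Submodule.map_top, Submodule.range_subtype]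

theorem continuous_ofFrame : Continuous (Gr2.ofFrame (A := A)) := continuous_coinduced_rng

theorem span_range_sum_smul_le {M : Type*} [AddCommGroup M] [Module ℂ M]
    (m : Fin 2 → Fin 2 → ℂ) (b : Fin 2 → M) :
    Submodule.span ℂ (Set.range fun j => ∑ k, m j k • b k) ≤
      Submodule.span ℂ (Set.range b) := by
  rw [Submodule.span_le]
  rintro _ ⟨j, rfl⟩
  exact Submodule.sum_mem _ fun k _ =>
    Submodule.smul_mem _ _ (Submodule.subset_span ⟨k, rfl⟩)

theorem sum_smul_sum_smul {M : Type*} [AddCommGroup M] [Module ℂ M]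
    (m n : Matrix (Fin 2) (Fin 2) ℂ) (b : Fin 2 → M) (j : Fin 2) :
    ∑ k, n j k • ∑ l, m k l • b l = ∑ l, (n * m) j l • b l := by
  simp only [Finset.smul_sum, smul_smul, Matrix.mul_apply, Finset.sum_smul]
  exact Finset.sum_comm

/-- Two frames of the same plane differ by an invertible matrix. -/
theorem exists_matrix_of_ofFrame_eq {b b' : Frame2 A} (h : Gr2.ofFrame b = Gr2.ofFrame b') :
    ∃ m n : Matrix (Fin 2) (Fin 2) ℂ, n * m = 1 ∧ ∀ j, b'.1 j = ∑ k, m j k • b.1 k := by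
  have hspan : Submodule.span ℂ (Set.range b.1) = Submodule.span ℂ (Set.range b'.1) :=
    congrArg Subtype.val h
  have hb' : ∀ j, ∃ c : Fin 2 → ℂ, ∑ k, c k • b.1 k = b'.1 j := fun j =>
    (Submodule.mem_span_range_iff_exists_fun ℂ).1
      (hspan ▸ Submodule.subset_span (Set.mem_range_self j))
  have hb : ∀ j, ∃ c : Fin 2 → ℂ, ∑ k, c k • b'.1 k = b.1 j := fun j =>
    (Submodule.mem_span_range_iff_exists_fun ℂ).1
      (hspan ▸ Submodule.subset_span (Set.mem_range_self j))
  choose m hm using hb'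
  choose n hn using hb
  refine ⟨m, n, ?_, fun j => (hm j).symm⟩
  ext j l
  -- Going to `b'` and back fixes `b`, so the rows of `n * m - 1` are linear relations among
  -- independent vectors.
  have hj : ∑ l, (Matrix.of n * Matrix.of m - 1) j l • b.1 l = 0 := by
    simp only [Matrix.sub_apply, sub_smul, Finset.sum_sub_distrib]
    rw [← sum_smul_sum_smul]
    simp only [Matrix.of_apply, hm, hn, Matrix.one_apply, ite_smul, one_smul, zero_smul,
      Finset.sum_ite_eq, Finset.mem_univ, if_true, sub_self]
  exact sub_eq_zero.1 (Fintype.linearIndependent_iff.1 b.2 _ hj l)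

theorem span_range_sum_smul_eq {M : Type*} [AddCommGroup M] [Module ℂ M]
    {m n : Matrix (Fin 2) (Fin 2) ℂ} (h : n * m = 1) (b : Fin 2 → M) :
    Submodule.span ℂ (Set.range fun j => ∑ k, m j k • b k) =
      Submodule.span ℂ (Set.range b) := by
  refine le_antisymm (span_range_sum_smul_le m b) ?_
  convert span_range_sum_smul_le n (fun j => ∑ k, m j k • b k) using 4 with j
  rw [sum_smul_sum_smul, h]
  simp [Matrix.one_apply]

/-- Changes of frame act continuously, so saturations of open sets are open. Openness is what
survives restriction to an arbitrary set of planes. -/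
theorem isOpenQuotientMap_ofFrame : IsOpenQuotientMap (Gr2.ofFrame (A := A)) := by
  refine ⟨Gr2.ofFrame_surjective, continuous_ofFrame, fun U hU => ?_⟩
  rw [isOpen_coinduced, isOpen_iff_mem_nhds]
  rintro b ⟨b', hb', hbb'⟩
  obtain ⟨m, n, hnm, hm⟩ := exists_matrix_of_ofFrame_eq hbb'.symm
  have hspan : ∀ c : Frame2 A, Submodule.span ℂ (Set.range fun j => ∑ k, m j k • c.1 k) =
      Submodule.span ℂ (Set.range c.1) := fun c => span_range_sum_smul_eq hnm c.1
  let φ : Frame2 A → Frame2 A := fun c => ⟨fun j => ∑ k, m j k • c.1 k, by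
    rw [linearIndependent_iff_card_eq_finrank_span, Set.finrank, hspan, finrank_span_eq_card c.2]⟩
  have hφ : Continuous φ := by
    refine Continuous.subtype_mk (continuous_pi fun j => continuous_finsetSum _ fun k _ => ?_) _
    exact ((continuous_apply k).comp continuous_subtype_val).const_smul (m j k)
  have hφb : φ b = b' := Subtype.ext (funext fun j => (hm j).symm)
  filter_upwards [hφ.continuousAt (hU.mem_nhds (hφb ▸ hb' : φ b ∈ U))] with c hc
  exact ⟨φ c, hc, Subtype.ext (hspan c)⟩

/-! ### The map on quotients -/

theorem mk_configOfSet_critSet_eq (hA' : A' ⊂ A) {r : ℕ} {W : Gr2 A}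
    (hW : W ∈ transversePencilsWith A A' r) {s s' : Sections A} (hs : s ∈ W.1)
    (hvs : VeryFull s) (hs' : s' ∈ W.1) (hvs' : VeryFull s') :
    Quotient.mk (scaleSetoid r) (configOfSet (critSet A' s) (hW.2 s hs hvs)) =
      Quotient.mk (scaleSetoid r) (configOfSet (critSet A' s') (hW.2 s' hs' hvs')) := by
  obtain ⟨w, hw⟩ := exists_mem_critSet_iff hA' hW.1.1 hs hvs hs' hvs'
  exact mk_configOfSet_eq_of_mul _ _ hw

/-- Translating the section by `t` keeps its critical set, so only the choice of section in `W'`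
remains to compare. -/
theorem mk_critMap_eq (hA' : A' ⊂ A) {r : ℕ} (i i' : OrbitChoice A A' r)
    {W W' : transversePencilsWith A A' r} (t : BigTorus d) (h : W'.1 = W.1.translate t) :
    Quotient.mk (scaleSetoid r) (critMap i W) = Quotient.mk (scaleSetoid r) (critMap i' W') := by
  have hmem : torusEquiv A t (i.1 W) ∈ W'.1.1 := by
    rw [h]
    exact Submodule.mem_map_of_mem (i.2 W).1
  have hvf : VeryFull (torusEquiv A t (i.1 W)) := (i.2 W).2.torusEquiv t
  rw [critMap, critMap, ← mk_configOfSet_critSet_eq hA' W'.2 hmem hvf (i'.2 W').1 (i'.2 W').2]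
  simp only [critSet_torusEquiv]

theorem nonempty_orbitChoice (A A' : Finset (Fin d → ℤ)) (r : ℕ) :
    Nonempty (OrbitChoice A A' r) := by
  have : ∀ W : transversePencilsWith A A' r, ∃ s ∈ W.1.1, VeryFull s := fun W => by
    obtain ⟨s, hs, -, hspan⟩ := W.2.1.1
    exact ⟨s, hspan ▸ Submodule.subset_span (by simp), hs⟩
  choose i hi hi' using this
  exact ⟨⟨i, fun W => ⟨hi W, hi' W⟩⟩⟩

theorem isOpen_setOf_veryFull : IsOpen {s : Sections A | VeryFull s} := by
  have : {s : Sections A | VeryFull s} = ⋂ α, {s | s α ≠ 0} := by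
    ext s
    simp [VeryFull]
  rw [this]
  exact isOpen_iInter_of_finite fun α => isOpen_ne_fun (continuous_apply α) continuous_const

/-- The choice `i` may be discontinuous; near each frame it is replaced by a continuous section,
which leaves the class modulo `ℂ^*` unchanged. -/
theorem continuous_mk_critMap (hA' : A' ⊂ A) {r : ℕ} (i : OrbitChoice A A' r) :
    Continuous fun W => Quotient.mk (scaleSetoid r) (critMap i W) := by
  have hq : IsOpenQuotientMap
      ((transversePencilsWith A A' r).restrictPreimage (Gr2.ofFrame (A := A))) :=
    ⟨isOpenQuotientMap_ofFrame.surjective.restrictPreimage _,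
      isOpenQuotientMap_ofFrame.continuous.restrictPreimage,
      isOpenQuotientMap_ofFrame.isOpenMap.restrictPreimage _⟩
  rw [← hq.continuous_comp_iff, continuous_iff_continuousAt]
  intro b₀
  set W := (transversePencilsWith A A' r).restrictPreimage (Gr2.ofFrame (A := A))
  -- Freezing the coordinates `c` of the chosen section in the frame `b₀` and letting the frame vary
  -- gives this section.
  obtain ⟨c, hc⟩ := (Submodule.mem_span_range_iff_exists_fun ℂ).1 (i.2 (W b₀)).1
  let s : Gr2.ofFrame (A := A) ⁻¹' transversePencilsWith A A' r → Sections A :=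
    fun b => ∑ k, c k • b.1.1 k
  have hs : Continuous s := continuous_finsetSum _ fun k _ =>
    ((continuous_apply k).comp (continuous_subtype_val.comp continuous_subtype_val)).const_smul (c k)
  have hmem : ∀ b, s b ∈ (W b).1.1 := fun b =>
    (Submodule.mem_span_range_iff_exists_fun ℂ).2 ⟨c, rfl⟩
  have hvf : ∀ᶠ b in 𝓝 b₀, VeryFull (s b) :=
    hs.continuousAt.eventually (isOpen_setOf_veryFull.mem_nhds
      (show VeryFull (s b₀) from (show s b₀ = i.1 (W b₀) from hc) ▸ (i.2 (W b₀)).2))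
  classical
  -- The second branch is a filler: near `b₀` the section is very full, so the first one applies.
  let g : Gr2.ofFrame (A := A) ⁻¹' transversePencilsWith A A' r → Config r := fun b =>
    if h : (critSet A' (s b)).encard = r then configOfSet _ h else critMap i (W b)
  have hg : ContinuousAt g b₀ := continuousAt_configOfSet (A' := A') hs <| by
    filter_upwards [hvf] with b hb
    have h := (W b).2.2 (s b) (hmem b) hb
    exact ⟨h, dif_pos h⟩
  refine (continuous_quotient_mk'.continuousAt.comp hg :
    ContinuousAt (fun b => Quotient.mk (scaleSetoid r) (g b)) b₀).congr ?_
  filter_upwards [hvf] with b hb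
  have h := (W b).2.2 (s b) (hmem b) hb
  refine (congrArg (Quotient.mk (scaleSetoid r)) (show g b = configOfSet _ h from dif_pos h)).trans ?_
  exact mk_configOfSet_critSet_eq hA' (W b).2 (hmem b) hb (i.2 (W b)).1 (i.2 (W b)).2

end SharpenedPencil

theorem mainTheorem8 {d : ℕ} (A A' : Finset (Fin d → ℤ))
    (hA : affineSpan ℝ
      ((fun (α : Fin d → ℤ) (j : Fin d) => (α j : ℝ)) '' (A : Set (Fin d → ℤ))) = ⊤)
    (hA' : A' ⊂ A) :
    (∀ W ∈ transversePencils A A', ∃ r : ℕ, W ∈ transversePencilsWith A A' r) ∧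
    ∀ r : ℕ,
      (∀ (t : BigTorus d), ∀ W ∈ transversePencilsWith A A' r,
        W.translate t ∈ transversePencilsWith A A' r) ∧
      (∀ i : OrbitChoice A A' r, Continuous i.1 → Continuous (critMap i)) ∧
      ∃ cTilde : PencilQuotient A A' r → ScaledConfig r,
        Continuous cTilde ∧
        ∀ (i : OrbitChoice A A' r) (W : transversePencilsWith A A' r),
          cTilde (Quotient.mk (pencilSetoid A A' r) W) =
            Quotient.mk (scaleSetoid r) (critMap i W) := by
  refine ⟨fun W hW => exists_mem_transversePencilsWith hA' hW, fun r =>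
    ⟨fun t W hW => translate_mem_transversePencilsWith t hW, continuous_critMap, ?_⟩⟩
  obtain ⟨i₀⟩ := nonempty_orbitChoice A A' r
  have hlift : ∀ W W' : transversePencilsWith A A' r, (pencilSetoid A A' r).r W W' →
      Quotient.mk (scaleSetoid r) (critMap i₀ W) = Quotient.mk (scaleSetoid r) (critMap i₀ W') :=
    fun W W' ⟨t, ht⟩ => mk_critMap_eq hA' i₀ i₀ t ht
  refine ⟨Quotient.lift _ hlift, (continuous_mk_critMap hA' i₀).quotient_lift hlift,
    fun i W => ?_⟩
  exact mk_configOfSet_critSet_eq hA' W.2 (i₀.2 W).1 (i₀.2 W).2 (i.2 W).1 (i.2 W).2
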